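/- **Setting.** Let $\mathbb E$ be a finite-dimensional Euclidean space, $m\ge 2$, $A_1,\dots,A_m\subseteq\mathbb E$ (indices cyclic, $m+1\equiv 1$) and $\lambda\in[0,1]$. For closed nonempty $A$ let $P_A(x)=\operatorname{argmin}_{a\in A}\|a-x\|$ (set-valued) and $R_A=2P_A-\mathrm{Id}$. Put $$T_{i,j}=\tfrac{\lambda}{2}(R_{A_i}R_{A_j}+\mathrm{Id})+(1-\lambda)P_{A_j},\qquad T=T_{1,2}\circ T_{2,3}\circ\dots\circ T_{m-1,m}\circ T_{m,1},$$ with pointwise sums and composition of set-valued maps, and $\mathrm{Fix}\,T=\{x: x\in Tx\}$. Let $U_1,\dots,U_m\subseteq\mathbb E$, let $\Lambda_j=P_{A_j}^{-1}(A_j\cap U_j)\cap U_j$ and let $\epsilon_{U_j}\in[0,1)$. Assume, for every $j$: * $A_j$ is nonempty and closed; * $U_j$ is an open neighborhood of some $x_j\in A_j$, on which $A_j$ is super-regular at a distance at $x_j$ relative to $\Lambda_j$ with constant $\epsilon_{U_j}$: $\langle v-(y'-y),y-x\rangle\le\epsilon_{U_j}\|v-(y'-y)\|\,\|y-x\|$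 for all $y'\in U_j\cap\Lambda_j$, $y\in P_{A_j}(y')$, and all $x$, $v$ with $v$ in the proximal normal cone of $A_j$ at $x$, $x+v\in U_j$ and $x\in P_{A_j}(x+v)$; * $R_{A_{j+1}}U_{j+1}\subseteq U_j$, $R_{A_{j+1}}\Lambda_{j+1}\subseteq\Lambda_j$, $T_{j,j+1}\Lambda_{j+1}\subseteq\Lambda_j$ and $T_{j,j+1}U_{j+1}\subseteq U_j$. Assume that $U_1$ contains a fixed point of $T$. Write $F=\mathrm{Fix}\,T\cap\Lambda_1$. A *gauge* is a continuous strictly increasing $\rho:[0,\infty)\to[0,\infty)$ with $\rho(0)=0$ and $\rho(t)\to\infty$ as $t\to\infty$. Assume that for some gauge $\rho$ $$\mathrm{dist}(x,F)\le\rho(\mathrm{dist}(x,Tx))\qquad\forall x\in U_1\cap\Lambda_1,$$ where $\mathrm{dist}(x,\emptyset)=\infty$. Let $$\tilde\epsilon_j=\frac{8\epsilon_{U_j}(1+\epsilon_{U_j})}{(1-\epsilon_{U_j})^2},\quad \epsilon_{j,j+1}=\tfrac12\Big[\big(\lambda\sqrt{1+\tilde\epsilon_j}+1-\lambda\big)^2(1+\tilde\epsilon_{j+1})-1\Big],\quad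 \epsilon=\prod_{j=1}^m(1+\epsilon_{j,j+1})-1,\quad \alpha=\frac m{m+1},$$ $$\theta(t)=\theta_{\alpha,\epsilon}(t)=\Big((1+\epsilon)t^2-\tfrac{1-\alpha}{\alpha}(\rho^{-1}(t))^2\Big)^{1/2},$$ where a negative radicand is replaced by $0$. Iterates are sequences with $x^{(k+1)}\in Tx^{(k)}$ for all $k\ge 0$, and $t_0=\mathrm{dist}(x^{(0)},F)$. **Theorem.** **(i)** For all $x\in U_1\cap\Lambda_1$ and $x^+\in Tx$: $\ \mathrm{dist}(x^+,F)\le\theta(\mathrm{dist}(x,F))$. Suppose in addition that $\theta$ is a gauge and that, for some $\bar t>0$, $0<\theta(t)<t$ for all $t\in(0,\bar t]$, and that one of the following holds, $\theta^{(k)}$ denoting the $k$-fold composition: * (a) $\theta^{(k)}(t)\to0$ as $k\to\infty$ for all $t\in(0,\bar t)$; * (b) $\sum_{j\ge1}\theta^{(j)}(t)<\infty$ for all $t\in(0,\bar t)$. Then there are $\delta>0$ and an open set $V\supseteq F$ such that all iterates with $x^{(0)}\in\Lambda_1$ and $\mathrm{dist}(x^{(0)},\mathrm{Fix}\,T\cap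 U_1)<\delta$, which in case (a) are also assumed Fejér monotone with respect to $\mathrm{Fix}\,T$ (that is, $\|x^{(k+1)}-y\|\le\|x^{(k)}-y\|$ for all $k$ and all $y\in\mathrm{Fix}\,T$), converge to a point $\bar x\in\mathrm{Fix}\,T$, with $\|x^{(k)}-\bar x\|=O(\theta^{(k)}(t_0))$ in case (a) and $\|x^{(k)}-\bar x\|=O\big(\sum_{j\ge k}\theta^{(j)}(t_0)\big)$ in case (b); and $\bar x\in\mathrm{Fix}\,T\cap\Lambda_1$ whenever $x^{(0)}\in V$. **(ii)** Suppose that $\rho(t)=\bar\kappa t$ with $\bar\kappa>0$, and that for some $\bar\alpha\in(0,1)$ and each $\bar\epsilon\in(0,1)$ there is an open set $U_{1,\bar\epsilon}\supseteq F$ on which $T$ is pointwise almost $\bar\alpha$-firmly nonexpansive at every $y\in F$ with violation $\bar\epsilon$, i.e. $$\|x^+-y^+\|^2\le(1+\bar\epsilon)\|x-y\|^2-\tfrac{1-\bar\alpha}{\bar\alpha}\|(x^+-x)-(y^+-y)\|^2\qquad\forall x\in U_{1,\bar\epsilon},\ x^+\in Tx,\ y^+\in Ty.$$ Then for each $\bar\epsilon\in(0,1)$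 with $\bar\epsilon<\frac{1-\bar\alpha}{\bar\kappa^2\bar\alpha}$ the number $\bar c:=\sqrt{1+\bar\epsilon-\frac{1-\bar\alpha}{\bar\kappa^2\bar\alpha}}$ (a negative radicand being replaced by $0$) satisfies $\bar c<1$, and there are open sets $N\supseteq\mathrm{Fix}\,T\cap U_1\cap U_{1,\bar\epsilon}$ and $V\supseteq F$ such that for all iterates with $x^{(0)}\in\Lambda_1\cap N$: $$\mathrm{dist}(x^{(k+1)},F)\le\bar c\,\mathrm{dist}(x^{(k)},F)\qquad\forall k\ge 0,$$ and $x^{(k)}$ converges R-linearly with rate $\bar c$ to some $\bar x\in\mathrm{Fix}\,T$, i.e. $\|x^{(k)}-\bar x\|\le C\bar c^{\,k}$ for all $k\ge 0$ and some constant $C$; and $\bar x\in\mathrm{Fix}\,T\cap\Lambda_1$ whenever $x^{(0)}\in V$. -/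

import Mathlib

open Filter Topology Asymptotics
open scoped NNReal ENNReal

namespace CDR

section SetValued

variable {E : Type*}

/-- The image `T S` of a set `S` under a set-valued mapping `T`. -/
def image (T : E → Set E) (S : Set E) : Set E := ⋃ a ∈ S, T a

/-- The inverse mapping `T⁻¹ a = {x | a ∈ T x}`. -/
def inv (T : E → Set E) (a : E) : Set E := {x | a ∈ T x}

/-- The composite `(T ∘ Q) x = ⋃ y ∈ Q x, T y`. -/
def comp (T Q : E → Set E) (x : E) : Set E := ⋃ y ∈ Q x, T y

/-- The fixed point set `{x | x ∈ T x}`. -/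
def Fix (T : E → Set E) : Set E := {x | x ∈ T x}

/-- `x` is a sequence of iterates: `x (k + 1) ∈ T (x k)` for all `k`. -/
def IsIteration (T : E → Set E) (x : ℕ → E) : Prop := ∀ k, x (k + 1) ∈ T (x k)

end SetValued

section Euclidean

variable {E : Type*} [NormedAddCommGroup E] [InnerProductSpace ℝ E]

/-- The metric projector: all nearest points of `A` to `x`. -/
def proj (A : Set E) (x : E) : Set E := {a | a ∈ A ∧ ∀ b ∈ A, ‖a - x‖ ≤ ‖b - x‖}

/-- The reflector `R_A = 2 P_A - Id`. -/
def refl (A : Set E) (x : E) : Set E := {z | ∃ p ∈ proj A x, z = (2 : ℝ) • p - x}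

/-- The proximal normal cone `cone (P_Ω⁻¹ a - a)`; it is empty when `a ∉ Ω`. -/
def proxNormalCone (Ω : Set E) (a : E) : Set E :=
  {v | ∃ τ : ℝ, 0 ≤ τ ∧ ∃ z ∈ inv (proj Ω) a, v = τ • (z - a)}

/-- `Ω` is super-regular at a distance at `xbar` relative to `Λ`, with constant `ε` on the
(open) neighborhood `U` of `xbar`. -/
def SuperRegularAt (Ω Λ : Set E) (xbar : E) (ε : ℝ) (U : Set E) : Prop :=
  IsOpen U ∧ xbar ∈ U ∧
    ∀ y' ∈ U ∩ Λ, ∀ y ∈ proj Ω y', ∀ x v : E,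
      v ∈ proxNormalCone Ω x → x + v ∈ U → x ∈ proj Ω (x + v) →
        inner ℝ (v - (y' - y)) (y - x) ≤ ε * ‖v - (y' - y)‖ * ‖y - x‖

/-- `T` is pointwise almost `α`-firmly nonexpansive at `y ∈ D` on `D` with constant `α ∈ (0,1)`
and violation `ε ∈ [0,1)`. -/
def PointwiseAFNE (T : E → Set E) (D : Set E) (y : E) (α ε : ℝ) : Prop :=
  y ∈ D ∧ 0 < α ∧ α < 1 ∧ 0 ≤ ε ∧ ε < 1 ∧
    ∀ x ∈ D, ∀ xp ∈ T x, ∀ yp ∈ T y,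
      ‖xp - yp‖ ^ 2 ≤ (1 + ε) * ‖x - y‖ ^ 2 - (1 - α) / α * ‖(xp - x) - (yp - y)‖ ^ 2

/-- The two-set relaxed Douglas-Rachford mapping
`(lam / 2) (R_A R_B + Id) + (1 - lam) P_B`, with pointwise (Minkowski) sums of sets. -/
def relaxedDR (lam : ℝ) (A B : Set E) (x : E) : Set E :=
  {z | ∃ r ∈ comp (refl A) (refl B) x, ∃ p ∈ proj B x,
    z = (lam / 2) • (r + x) + (1 - lam) • p}

variable {m : ℕ} [NeZero m]

/-- The cyclic relaxed Douglas-Rachford mapping `T_{1,2} ∘ T_{2,3} ∘ ⋯ ∘ T_{m,1}`. The sets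
`A_1, …, A_m` are indexed by `0, …, m - 1`, and `j + 1` is taken cyclically in `Fin m`. -/
def cyclicDR (lam : ℝ) (A : Fin m → Set E) : E → Set E :=
  ((List.finRange m).map fun j => relaxedDR lam (A j) (A (j + 1))).foldr comp fun x => {x}

/-- `Λ_j = P_{A_j}⁻¹ (A_j ∩ U_j) ∩ U_j`. -/
def Lam (A U : Fin m → Set E) (j : Fin m) : Set E :=
  image (inv (proj (A j))) (A j ∩ U j) ∩ U j

/-- The standing assumptions on the sets `A_j`, the neighborhoods `U_j` and the regularity
constants `e j ∈ [0,1)`. -/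
structure Standing (lam : ℝ) (A U : Fin m → Set E) (e : Fin m → ℝ) : Prop where
  nonempty : ∀ j, (A j).Nonempty
  closed : ∀ j, IsClosed (A j)
  const_nonneg : ∀ j, 0 ≤ e j
  const_lt_one : ∀ j, e j < 1
  superRegular : ∀ j, ∃ x ∈ A j, SuperRegularAt (A j) (Lam A U j) x (e j) (U j)
  refl_nbhd : ∀ j, image (refl (A (j + 1))) (U (j + 1)) ⊆ U j
  refl_Lam : ∀ j, image (refl (A (j + 1))) (Lam A U (j + 1)) ⊆ Lam A U j
  dr_Lam : ∀ j, image (relaxedDR lam (A j) (A (j + 1))) (Lam A U (j + 1)) ⊆ Lam A U j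
  dr_nbhd : ∀ j, image (relaxedDR lam (A j) (A (j + 1))) (U (j + 1)) ⊆ U j

/-- The violation of a reflector across a set with regularity constant `e`. -/
noncomputable def reflViolation (e : ℝ) : ℝ := 8 * e * (1 + e) / (1 - e) ^ 2

/-- The violation `ε_{j,j+1}` of the two-set mapping. -/
noncomputable def stepViolation (lam : ℝ) (e : Fin m → ℝ) (j : Fin m) : ℝ :=
  1 / 2 * ((lam * √(1 + reflViolation (e j)) + 1 - lam) ^ 2
    * (1 + reflViolation (e (j + 1))) - 1)

/-- The violation `ε = ∏ (1 + ε_{j,j+1}) - 1` of the cyclic mapping. -/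
noncomputable def violation (lam : ℝ) (e : Fin m → ℝ) : ℝ :=
  (∏ j, (1 + stepViolation lam e j)) - 1

/-- The averaging constant `m / (m + 1)` of the cyclic mapping. -/
noncomputable def averaging (m : ℕ) : ℝ := (m : ℝ) / (m + 1)

/-- Metric subregularity with gauge `ρ`: `dist (x, F) ≤ ρ (dist (x, T x))` for `x ∈ D`. The left
side is the extended distance, which is `∞` for empty `F`. -/
def MetricSubregular (T : E → Set E) (F D : Set E) (ρ : ℝ≥0 → ℝ≥0) : Prop :=
  ∀ x ∈ D, Metric.infEDist x F ≤ (ρ (Metric.infNndist x (T x)) : ℝ≥0∞)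

/-- Fejér monotonicity of a sequence with respect to a set. -/
def FejerMonotone (x : ℕ → E) (S : Set E) : Prop :=
  ∀ k, ∀ y ∈ S, dist (x (k + 1)) y ≤ dist (x k) y

/-- R-linear convergence of `x` to `xbar` with rate `c ∈ [0,1)`. -/
def RLinear (x : ℕ → E) (xbar : E) (c : ℝ) : Prop :=
  0 ≤ c ∧ c < 1 ∧ ∃ C : ℝ, ∀ k, dist (x k) xbar ≤ C * c ^ k

end Euclidean

/-- Gauge functions on `[0, ∞)`. -/
structure IsGauge (ρ : ℝ≥0 → ℝ≥0) : Prop where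
  continuous : Continuous ρ
  strictMono : StrictMono ρ
  zero : ρ 0 = 0
  tendsto : Tendsto ρ atTop atTop

/-- `θ_{α,ε}(t) = ((1 + ε) t² - ((1 - α) / α) (ρ⁻¹ t)²)^{1/2}`. -/
noncomputable def theta (ρ : ℝ≥0 → ℝ≥0) (α ε : ℝ) (t : ℝ≥0) : ℝ≥0 :=
  Real.toNNReal √((1 + ε) * (t : ℝ) ^ 2
    - (1 - α) / α * ((Function.invFun ρ t : ℝ≥0) : ℝ) ^ 2)

/-- `θ` is a gauge with `0 < θ t < t` on `(0, tbar]`. -/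
def ThetaAdmissible (θ : ℝ≥0 → ℝ≥0) (tbar : ℝ≥0) : Prop :=
  0 < tbar ∧ IsGauge θ ∧ ∀ t, 0 < t → t ≤ tbar → 0 < θ t ∧ θ t < t

end CDR

namespace CDR

/-! The core is one inequality: for `x ∈ U_1`, `y ∈ Λ_1` and values `x⁺`, `y⁺` of the cyclic map,
`‖x⁺ - y⁺‖² ≤ (1 + ε)‖x - y‖² - (1/m)‖(x⁺ - x) - (y⁺ - y)‖²`. Super-regularity makes each reflector
almost nonexpansive at points of `Λ_j`. Each two-set map is the midpoint of the identity and a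
convex combination of such maps, and so is almost averaged. Violations multiply along the cycle, and
Cauchy-Schwarz over the `m` steps costs the factor `1/m` (`Standing.norm_cyclicDR_sub_sq_le`). The
inequality is asymmetric: only `y` must lie in `Λ_1`. It is used twice. With `y ∈ F`, it bounds a
step by a multiple of `dist(x, F)`. Combined with subregularity, which bounds the step from below by
`ρ⁻¹(dist(x, F))`, it gives the decrease by `θ`. With the iterate as base point and a fixed point `z
∈ U_1`, possibly outside `Λ_1`, as the other argument, it bounds the step by a multiple of `‖x -
z‖`. By subregularity, a start close to `Fix T ∩ U_1` is then close to `F`. Convergence follows from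
Fejér monotonicity or from summable step lengths. The limit lies in `closure F`, which is contained
in `Fix T` because `T` is upper semicontinuous with compact values (`ultraUSC_cyclicDR`). `F` need
not be closed, but `Λ_1` is open (`Standing.isOpen_Lam`), so a start close enough to `F` keeps the
limit in `Λ_1`. -/

lemma Lam_subset {E : Type*} [NormedAddCommGroup E] {m : ℕ} {A U : Fin m → Set E}
    (j : Fin m) : Lam A U j ⊆ U j :=
  Set.inter_subset_right

/-! ### Almost averagedness of the reflectors, the two-set maps and the cycle. -/

section Averaging

variable {E : Type*} [NormedAddCommGroup E] [InnerProductSpace ℝ E]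

lemma reflViolation_nonneg {e : ℝ} (he : 0 ≤ e) : 0 ≤ reflViolation e := by
  unfold reflViolation; positivity

/-- The polarization argument for a reflector produces the violation `2e / (1 - e)`; the violation
of the theorem is larger. -/
lemma two_mul_div_le_reflViolation {e : ℝ} (he : 0 ≤ e) (he1 : e < 1) :
    2 * e / (1 - e) ≤ reflViolation e := by
  unfold reflViolation
  have h : 0 < 1 - e := by linarith
  rw [div_le_div_iff₀ h (by positivity)]
  have h1 : 0 ≤ e * (1 - e) := by positivity
  nlinarith [mul_nonneg h1 he]

/-- If `⟨p, q⟩` is almost nonnegative, then `p - q` is almost no longer than `p + q`. -/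
lemma norm_sub_sq_le_of_inner_ge {p q : E} {e : ℝ} (he : 0 ≤ e) (he1 : e < 1)
    (h : -(e * ‖p‖ * ‖q‖) ≤ inner ℝ p q) :
    ‖p - q‖ ^ 2 ≤ (1 + reflViolation e) * ‖p + q‖ ^ 2 := by
  have h1 := norm_add_sq_real p q
  have h2 := norm_sub_sq_real p q
  have hpos : 0 < 1 - e := by linarith
  have h3 : 2 * (1 - e) * (‖p‖ * ‖q‖) ≤ ‖p + q‖ ^ 2 := by
    nlinarith [sq_nonneg (‖p‖ - ‖q‖)]
  have h4 : 4 * e * (‖p‖ * ‖q‖) ≤ 2 * e / (1 - e) * ‖p + q‖ ^ 2 := by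
    have := mul_le_mul_of_nonneg_left h3 (show 0 ≤ 2 * e / (1 - e) by positivity)
    refine le_trans (le_of_eq ?_) this
    field_simp
    ring
  have h5 := mul_le_mul_of_nonneg_right (two_mul_div_le_reflViolation he he1)
    (sq_nonneg ‖p + q‖)
  nlinarith

/-- Super-regularity at a distance makes the reflector pointwise almost nonexpansive. -/
lemma SuperRegularAt.norm_refl_sub_refl_le {Ω Λ U : Set E} {xbar : E} {e : ℝ}
    (h : SuperRegularAt Ω Λ xbar e U) (he : 0 ≤ e) (he1 : e < 1) {x y r s : E} (hx : x ∈ U)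
    (hy : y ∈ U) (hyΛ : y ∈ Λ) (hr : r ∈ refl Ω x) (hs : s ∈ refl Ω y) :
    ‖r - s‖ ≤ √(1 + reflViolation e) * ‖x - y‖ := by
  obtain ⟨p, hp, rfl⟩ := hr
  obtain ⟨q, hq, rfl⟩ := hs
  -- The proximal normal at `p` is `x - p`. Nearest-point differences and residual differences then
  -- have almost nonnegative inner product; their sum is `x - y` and their difference is `r - s`.
  have key := h.2.2 y ⟨hy, hyΛ⟩ q hq p (x - p)
    ⟨1, zero_le_one, x, hp, by simp⟩ (by simpa using hx) (by simpa using hp)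
  have h1 : ‖(p - q) - ((x - p) - (y - q))‖ ^ 2
      ≤ (1 + reflViolation e) * ‖(p - q) + ((x - p) - (y - q))‖ ^ 2 := by
    apply norm_sub_sq_le_of_inner_ge he he1
    rw [← neg_sub p q, inner_neg_right, norm_neg, real_inner_comm] at key
    linarith
  have e1 : (p - q) - ((x - p) - (y - q)) = (2 : ℝ) • p - x - ((2 : ℝ) • q - y) := by
    module
  have e2 : (p - q) + ((x - p) - (y - q)) = x - y := by abel
  rw [e1, e2] at h1
  apply le_of_sq_le_sq _ (by positivity)
  rwa [mul_pow, Real.sq_sqrt (by have := reflViolation_nonneg he; linarith)]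

/-- Parallelogram law: averaging with the identity halves the excess `K - 1` and leaves the squared
displacement as a gain. -/
lemma norm_half_add_sq_le {a b : E} {K : ℝ} (h : ‖b‖ ^ 2 ≤ K * ‖a‖ ^ 2) :
    ‖(1 / 2 : ℝ) • (a + b)‖ ^ 2
      ≤ (1 + 1 / 2 * (K - 1)) * ‖a‖ ^ 2 - ‖(1 / 2 : ℝ) • (a + b) - a‖ ^ 2 := by
  have e1 : (1 / 2 : ℝ) • (a + b) - a = (1 / 2 : ℝ) • (b - a) := by module
  rw [e1, norm_smul, norm_smul, mul_pow, mul_pow]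
  have h1 := norm_add_sq_real a b
  have h2 := norm_sub_sq_real b a
  rw [real_inner_comm] at h2
  norm_num
  nlinarith

variable {m : ℕ} [NeZero m] {lam : ℝ} {A U : Fin m → Set E} {e : Fin m → ℝ}

lemma Standing.norm_refl_sub_refl_le (hA : Standing lam A U e) {j : Fin m} {x y r s : E}
    (hx : x ∈ U j) (hy : y ∈ Lam A U j) (hr : r ∈ refl (A j) x) (hs : s ∈ refl (A j) y) :
    ‖r - s‖ ≤ √(1 + reflViolation (e j)) * ‖x - y‖ := by
  obtain ⟨c, -, hc⟩ := hA.superRegular j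
  exact hc.norm_refl_sub_refl_le (hA.const_nonneg j) (hA.const_lt_one j) hx
    (Lam_subset j hy) hy hr hs

lemma mem_image {X : Type*} {T : X → Set X} {S : Set X} {x z : X} (hx : x ∈ S)
    (hz : z ∈ T x) : z ∈ image T S :=
  Set.mem_biUnion hx hz

lemma mem_comp {X : Type*} {T Q : X → Set X} {x z : X} :
    z ∈ comp T Q x ↔ ∃ y ∈ Q x, z ∈ T y := by
  simp [comp]

/-- Every value of the relaxed Douglas-Rachford mapping is a midpoint of `x` and a convex
combination of values of `R_A R_B` and `R_B`. -/
lemma exists_of_mem_relaxedDR {A B : Set E} {x z : E} (hz : z ∈ relaxedDR lam A B x) :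
    ∃ b ∈ refl B x, ∃ r ∈ refl A b, ∃ s ∈ refl B x,
      z = (1 / 2 : ℝ) • (x + (lam • r + (1 - lam) • s)) := by
  obtain ⟨r, hr, p, hp, rfl⟩ := hz
  obtain ⟨b, hb, hr⟩ := mem_comp.1 hr
  exact ⟨b, hb, r, hr, _, ⟨p, hp, rfl⟩, by module⟩

lemma Standing.norm_relaxedDR_sub_sq_le (hA : Standing lam A U e) (hlam0 : 0 ≤ lam)
    (hlam1 : lam ≤ 1) {j : Fin m} {x y xp yp : E} (hx : x ∈ U (j + 1))
    (hy : y ∈ Lam A U (j + 1)) (hxp : xp ∈ relaxedDR lam (A j) (A (j + 1)) x)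
    (hyp : yp ∈ relaxedDR lam (A j) (A (j + 1)) y) :
    ‖xp - yp‖ ^ 2
      ≤ (1 + stepViolation lam e j) * ‖x - y‖ ^ 2 - ‖(xp - x) - (yp - y)‖ ^ 2 := by
  obtain ⟨b, hb, r, hr, s, hs, rfl⟩ := exists_of_mem_relaxedDR hxp
  obtain ⟨b', hb', r', hr', s', hs', rfl⟩ := exists_of_mem_relaxedDR hyp
  have h1 := hA.norm_refl_sub_refl_le hx hy hb hb'
  have h2 := hA.norm_refl_sub_refl_le hx hy hs hs'
  have h3 := hA.norm_refl_sub_refl_le (hA.refl_nbhd j (mem_image hx hb))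
    (hA.refl_Lam j (mem_image hy hb')) hr hr'
  have h0 := hA.const_nonneg
  set κ := √(1 + reflViolation (e j)) with hκ
  set μ := √(1 + reflViolation (e (j + 1))) with hμ
  have hκ0 : 0 ≤ κ := Real.sqrt_nonneg _
  have hμ2 : μ ^ 2 = 1 + reflViolation (e (j + 1)) :=
    Real.sq_sqrt (by have := reflViolation_nonneg (h0 (j + 1)); linarith)
  have h4 : ‖lam • (r - r') + (1 - lam) • (s - s')‖
      ≤ (lam * κ + 1 - lam) * μ * ‖x - y‖ := by
    refine (norm_add_le _ _).trans ?_
    rw [norm_smul, norm_smul, Real.norm_of_nonneg hlam0,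
      Real.norm_of_nonneg (sub_nonneg.2 hlam1)]
    have h5 : ‖r - r'‖ ≤ κ * (μ * ‖x - y‖) :=
      h3.trans (mul_le_mul_of_nonneg_left h1 hκ0)
    have := mul_le_mul_of_nonneg_left h5 hlam0
    have := mul_le_mul_of_nonneg_left h2 (sub_nonneg.2 hlam1)
    linarith
  have h5 : ‖lam • (r - r') + (1 - lam) • (s - s')‖ ^ 2
      ≤ ((lam * κ + 1 - lam) ^ 2 * (1 + reflViolation (e (j + 1)))) * ‖x - y‖ ^ 2 := by
    rw [← hμ2, ← mul_pow, ← mul_pow]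
    exact pow_le_pow_left₀ (norm_nonneg _) h4 2
  have h6 := norm_half_add_sq_le h5
  have e1 : ∀ w w' : E, w - x - (w' - y) = w - w' - (x - y) := fun w w' => by abel
  have e2 : (1 / 2 : ℝ) • (x + (lam • r + (1 - lam) • s))
      - (1 / 2 : ℝ) • (y + (lam • r' + (1 - lam) • s'))
      = (1 / 2 : ℝ) • ((x - y) + (lam • (r - r') + (1 - lam) • (s - s'))) := by module
  rwa [e1, e2]

lemma Standing.stepViolation_nonneg (hA : Standing lam A U e) (hlam0 : 0 ≤ lam)
    (j : Fin m) : 0 ≤ stepViolation lam e j := by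
  have h1 := reflViolation_nonneg (hA.const_nonneg j)
  have h2 := reflViolation_nonneg (hA.const_nonneg (j + 1))
  have h3 : 1 ≤ √(1 + reflViolation (e j)) := Real.one_le_sqrt.2 (by linarith)
  have h4 : 1 ≤ lam * √(1 + reflViolation (e j)) + 1 - lam := by nlinarith
  have h5 := one_le_mul_of_one_le_of_one_le (one_le_pow₀ h4 (n := 2))
    (show 1 ≤ 1 + reflViolation (e (j + 1)) by linarith)
  unfold stepViolation
  linarith

lemma Standing.violation_nonneg (hA : Standing lam A U e) (hlam0 : 0 ≤ lam) :
    0 ≤ violation lam e := by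
  have : (1 : ℝ) ≤ ∏ j, (1 + stepViolation lam e j) := by
    simpa using Finset.prod_le_prod (s := Finset.univ) (f := fun _ : Fin m => (1 : ℝ))
      (fun _ _ => zero_le_one) fun j _ => le_add_of_nonneg_right (hA.stepViolation_nonneg hlam0 j)
  unfold violation
  linarith

/-- The trailing `0` is the index of the region holding the initial argument, so each mapping is
followed in the list by the index of the region it acts on, including the cyclic wrap. -/
lemma isChain_finRange_append_zero :
    (List.finRange m ++ [0]).IsChain fun a b => a + 1 = b := by
  rw [List.isChain_iff_getElem]
  intro i hi
  simp only [List.length_append, List.length_finRange, List.length_singleton] at hi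
  have him : i < m := by omega
  rw [List.getElem_append_left (by simpa using him)]
  by_cases h : i + 1 < m
  · rw [List.getElem_append_left (by simpa using h)]
    ext
    have h1 : 1 % m = 1 := Nat.mod_eq_of_lt (by omega)
    simp [Fin.val_add, h1, Nat.mod_eq_of_lt h]
  · rw [List.getElem_append_right (by simpa using h)]
    have : i + 1 = m := by omega
    ext
    simp [Fin.val_add, this]

/-- Composition of two-set mappings along a chain of indices that ends in `0`. -/
lemma Standing.foldr_comp (hA : Standing lam A U e) (hlam0 : 0 ≤ lam) (hlam1 : lam ≤ 1)
    {x y : E} (hx : x ∈ U 0) (hy : y ∈ Lam A U 0) :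
    ∀ l : List (Fin m), (l ++ [0]).IsChain (fun a b => a + 1 = b) →
      ∀ i, (l ++ [0]).head? = some i → ∀ xp yp : E,
        xp ∈ (l.map fun j => relaxedDR lam (A j) (A (j + 1))).foldr comp (fun x => {x}) x →
        yp ∈ (l.map fun j => relaxedDR lam (A j) (A (j + 1))).foldr comp (fun x => {x}) y →
        xp ∈ U i ∧ yp ∈ Lam A U i ∧ ∃ S : ℝ, ‖(xp - x) - (yp - y)‖ ^ 2 ≤ l.length * S ∧
          0 ≤ S ∧ ‖xp - yp‖ ^ 2
            ≤ (l.map fun j => 1 + stepViolation lam e j).prod * ‖x - y‖ ^ 2 - S := by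
  intro l
  induction l with
  | nil =>
    intro _ i hi xp yp hxp hyp
    simp only [List.nil_append, List.head?_cons, Option.some.injEq, List.map_nil,
      List.foldr_nil, Set.mem_singleton_iff] at hi hxp hyp
    subst hi hxp hyp
    exact ⟨hx, hy, 0, by simp⟩
  | cons a l ih =>
    intro hl i hi xp yp hxp hyp
    simp only [List.cons_append, List.head?_cons, Option.some.injEq] at hi
    subst hi
    simp only [List.map_cons, List.foldr_cons, mem_comp] at hxp hyp
    obtain ⟨x', hx', hxp⟩ := hxp
    obtain ⟨y', hy', hyp⟩ := hyp
    obtain ⟨b, hb⟩ : ∃ b, (l ++ [0]).head? = some b := by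
      cases l <;> simp
    have hab : a + 1 = b := by
      rw [List.cons_append, List.isChain_cons] at hl
      exact hl.1 b hb
    subst hab
    obtain ⟨h1, h2, S, h3, h4, h5⟩ := ih (List.IsChain.tail hl) _ hb x' y' hx' hy'
    have hs := hA.norm_relaxedDR_sub_sq_le hlam0 hlam1 h1 h2 hxp hyp
    have hv := hA.stepViolation_nonneg hlam0 a
    set D := ‖(xp - x') - (yp - y')‖ with hD
    -- `S` is the sum of the squared displacement differences of the steps already applied; `D ^ 2`
    -- is the term of the new step.
    refine ⟨hA.dr_nbhd a (mem_image h1 hxp), hA.dr_Lam a (mem_image h2 hyp), S + D ^ 2, ?_,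
      by positivity, ?_⟩
    · have hle : ‖(xp - x) - (yp - y)‖ ≤ ‖(x' - x) - (y' - y)‖ + D := by
        refine le_trans (le_of_eq ?_) (norm_add_le _ _)
        congr 1
        abel
      set d := ‖(x' - x) - (y' - y)‖
      set n : ℝ := (l.length : ℝ)
      have hn : 0 ≤ n := Nat.cast_nonneg _
      have : ‖(xp - x) - (yp - y)‖ ^ 2 ≤ (d + D) ^ 2 :=
        pow_le_pow_left₀ (norm_nonneg _) hle 2
      have hlen : ((a :: l).length : ℝ) = n + 1 := by simp [n]
      rw [hlen]
      have hd0 : 0 ≤ d := norm_nonneg _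
      -- Cauchy-Schwarz: `(d + D)² ≤ (n + 1) (S + D²)` when `d² ≤ n S`
      have h6 : 2 * d * D ≤ S + n * D ^ 2 := by
        apply le_of_sq_le_sq _ (by positivity)
        have h7 := mul_le_mul_of_nonneg_right h3 (sq_nonneg D)
        nlinarith [sq_nonneg (S - n * D ^ 2)]
      nlinarith
    · simp only [List.map_cons, List.prod_cons]
      -- The new factor also multiplies `-S`; being at least `1`, it only helps, and the surplus is
      -- dropped.
      have := mul_le_mul_of_nonneg_left h5 (show 0 ≤ 1 + stepViolation lam e a by linarith)
      nlinarith [mul_nonneg hv h4]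

/-- The cyclic mapping is pointwise almost averaged on `U_1` at every point of `Λ_1`. -/
lemma Standing.norm_cyclicDR_sub_sq_le (hA : Standing lam A U e) (hlam0 : 0 ≤ lam)
    (hlam1 : lam ≤ 1) {x y xp yp : E} (hx : x ∈ U 0) (hy : y ∈ Lam A U 0)
    (hxp : xp ∈ cyclicDR lam A x) (hyp : yp ∈ cyclicDR lam A y) :
    yp ∈ Lam A U 0 ∧ ‖xp - yp‖ ^ 2 ≤ (1 + violation lam e) * ‖x - y‖ ^ 2
      - (1 - averaging m) / averaging m * ‖(xp - x) - (yp - y)‖ ^ 2 := by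
  have hhead : (List.finRange m ++ [0]).head? = some 0 := by
    obtain ⟨n, rfl⟩ := Nat.exists_eq_succ_of_ne_zero (NeZero.ne m)
    simp [List.finRange_succ]
  obtain ⟨-, h1, S, h2, -, h3⟩ := hA.foldr_comp hlam0 hlam1 hx hy _
    isChain_finRange_append_zero 0 hhead xp yp hxp hyp
  refine ⟨h1, ?_⟩
  have hm : (0 : ℝ) < m := Nat.cast_pos.2 (Nat.pos_of_ne_zero (NeZero.ne m))
  have e1 : (1 - averaging m) / averaging m = 1 / (m : ℝ) := by
    unfold averaging; field_simp; ring
  have e2 : ((List.finRange m).map fun j => 1 + stepViolation lam e j).prod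
      = 1 + violation lam e := by
    rw [violation, ← List.prod_ofFn, List.ofFn_eq_map]; ring
  rw [e2] at h3
  rw [List.length_finRange] at h2
  have h4 : 1 / (m : ℝ) * ‖(xp - x) - (yp - y)‖ ^ 2 ≤ S := by
    rw [one_div_mul_eq_div, div_le_iff₀ hm]; linarith
  rw [e1]
  linarith

end Averaging

/-! ### Upper semicontinuity of the mappings, and openness of `Λ_j`. -/

section Semicontinuity

/-- Upper semicontinuity with compact values, in terms of ultrafilters: along an ultrafilter on
which the argument converges to `x`, every selection of values converges to a value at `x`. -/
def UltraUSC {X : Type*} [TopologicalSpace X] (T : X → Set X) : Prop :=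
  ∀ (𝒰 : Ultrafilter X) (u z : X → X) (x : X), Tendsto u 𝒰 (𝓝 x) →
    (∀ᶠ i in 𝒰, z i ∈ T (u i)) → ∃ w ∈ T x, Tendsto z 𝒰 (𝓝 w)

/-- Intermediate values can be chosen eventually, and along an ultrafilter the chosen selection
converges outright, so no subsequences have to be extracted. -/
lemma UltraUSC.comp {X : Type*} [TopologicalSpace X] {T Q : X → Set X} (hT : UltraUSC T)
    (hQ : UltraUSC Q) : UltraUSC (comp T Q) := by
  intro 𝒰 u z x hu hz
  have h : ∀ᶠ i in 𝒰, ∃ y, y ∈ Q (u i) ∧ z i ∈ T y := by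
    filter_upwards [hz] with i hi using mem_comp.1 hi
  obtain ⟨y, hy⟩ := h.choice
  obtain ⟨w, hw, hyw⟩ := hQ 𝒰 u y x hu (hy.mono fun _ h => h.1)
  obtain ⟨v, hv, hzv⟩ := hT 𝒰 y z w hyw (hy.mono fun _ h => h.2)
  exact ⟨v, mem_comp.2 ⟨w, hw, hv⟩, hzv⟩

lemma UltraUSC.isClosed_Fix {X : Type*} [TopologicalSpace X] [T2Space X] {T : X → Set X}
    (hT : UltraUSC T) : IsClosed (Fix T) := by
  rw [isClosed_iff_ultrafilter]
  intro x 𝒰 hx hF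
  obtain ⟨w, hw, h⟩ := hT 𝒰 id id x hx hF
  rwa [tendsto_nhds_unique h hx] at hw

variable {E : Type*} [NormedAddCommGroup E] [InnerProductSpace ℝ E]

lemma proj_nonempty [FiniteDimensional ℝ E] {A : Set E} (hA : IsClosed A)
    (hne : A.Nonempty) (x : E) : (proj A x).Nonempty := by
  have := FiniteDimensional.proper ℝ E
  obtain ⟨a, ha, h⟩ := hA.exists_infDist_eq_dist hne x
  refine ⟨a, ha, fun b hb => ?_⟩
  rw [← dist_eq_norm, ← dist_eq_norm, dist_comm a, dist_comm b, ← h]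
  exact Metric.infDist_le_dist_of_mem hb

lemma ultraUSC_proj [FiniteDimensional ℝ E] {A : Set E} (hA : IsClosed A) :
    UltraUSC (proj A) := by
  have := FiniteDimensional.proper ℝ E
  intro 𝒰 u z x hu hz
  obtain ⟨i₀, hi₀⟩ := hz.exists
  have hb := hi₀.1
  set b := z i₀
  -- Comparison with one fixed `b ∈ A` keeps the nearest points bounded; each of the two changes of
  -- base point between `u i` and `x` costs at most `1`.
  have hbd : ∀ᶠ i in 𝒰, z i ∈ Metric.closedBall x (‖b - x‖ + 2) := by
    filter_upwards [hz, hu (Metric.ball_mem_nhds x one_pos)] with i hi hui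
    have h1 : dist (u i) x < 1 := hui
    have h2 := hi.2 b hb
    rw [← dist_eq_norm, ← dist_eq_norm] at h2
    rw [Metric.mem_closedBall, ← dist_eq_norm]
    have h3 := dist_triangle (z i) (u i) x
    have h4 := dist_triangle_right b (u i) x
    linarith
  obtain ⟨w, -, hw⟩ := (isCompact_closedBall x (‖b - x‖ + 2)).ultrafilter_le_nhds (𝒰.map z)
    (by rw [le_principal_iff]; exact hbd)
  have hw : Tendsto z 𝒰 (𝓝 w) := hw
  refine ⟨w, ⟨hA.mem_of_tendsto hw (hz.mono fun _ h => h.1), fun c hc => ?_⟩, hw⟩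
  exact le_of_tendsto_of_tendsto (hw.sub hu).norm (tendsto_const_nhds.sub hu).norm
    (hz.mono fun _ h => h.2 c hc)

lemma ultraUSC_refl [FiniteDimensional ℝ E] {A : Set E} (hA : IsClosed A) :
    UltraUSC (refl A) := by
  intro 𝒰 u z x hu hz
  have h : ∀ᶠ i in 𝒰, ∃ p, p ∈ proj A (u i) ∧ z i = (2 : ℝ) • p - u i := hz
  obtain ⟨p, hp⟩ := h.choice
  obtain ⟨w, hw, hpw⟩ := ultraUSC_proj hA 𝒰 u p x hu (hp.mono fun _ h => h.1)
  exact ⟨_, ⟨w, hw, rfl⟩, ((hpw.const_smul (2 : ℝ)).sub hu).congr'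
    (hp.mono fun _ h => h.2.symm)⟩

lemma ultraUSC_relaxedDR [FiniteDimensional ℝ E] {A B : Set E} (hA : IsClosed A)
    (hB : IsClosed B) (lam : ℝ) : UltraUSC (relaxedDR lam A B) := by
  intro 𝒰 u z x hu hz
  have h : ∀ᶠ i in 𝒰, ∃ q : E × E, q.1 ∈ comp (refl A) (refl B) (u i) ∧ q.2 ∈ proj B (u i) ∧
      z i = (lam / 2) • (q.1 + u i) + (1 - lam) • q.2 := by
    filter_upwards [hz] with i ⟨r, hr, p, hp, h⟩ using ⟨(r, p), hr, hp, h⟩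
  obtain ⟨q, hq⟩ := h.choice
  obtain ⟨r, hr, hqr⟩ := (ultraUSC_refl hA).comp (ultraUSC_refl hB) 𝒰 u (fun i => (q i).1) x hu
    (hq.mono fun _ h => h.1)
  obtain ⟨p, hp, hqp⟩ := ultraUSC_proj hB 𝒰 u (fun i => (q i).2) x hu
    (hq.mono fun _ h => h.2.1)
  exact ⟨_, ⟨r, hr, p, hp, rfl⟩, (((hqr.add hu).const_smul (lam / 2)).add
    (hqp.const_smul (1 - lam))).congr' (hq.mono fun _ h => h.2.2.symm)⟩

lemma ultraUSC_cyclicDR [FiniteDimensional ℝ E] {m : ℕ} [NeZero m] {A : Fin m → Set E}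
    (hA : ∀ j, IsClosed (A j)) (lam : ℝ) : UltraUSC (cyclicDR lam A) := by
  unfold cyclicDR
  induction List.finRange m with
  | nil =>
    intro 𝒰 u z x hu hz
    exact ⟨x, rfl, hu.congr' (hz.mono fun _ h => h.symm)⟩
  | cons a l ih => exact (ultraUSC_relaxedDR (hA a) (hA (a + 1)) lam).comp ih

/-- At a point of `Λ_j` the projector is single-valued, hence `Λ_j` is open. -/
lemma Standing.isOpen_Lam [FiniteDimensional ℝ E] {m : ℕ} [NeZero m] {lam : ℝ}
    {A U : Fin m → Set E} {e : Fin m → ℝ} (hA : Standing lam A U e) (j : Fin m) :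
    IsOpen (Lam A U j) := by
  rw [isOpen_iff_mem_nhds]
  intro y hy
  obtain ⟨a, ⟨-, haU⟩, hya⟩ : ∃ a ∈ A j ∩ U j, y ∈ inv (proj (A j)) a := by
    simpa only [image, Set.mem_iUnion, exists_prop] using hy.1
  have hUo : IsOpen (U j) := by
    obtain ⟨c, -, hc⟩ := hA.superRegular j
    exact hc.1
  rw [mem_iff_ultrafilter]
  intro 𝒰 h𝒰
  choose z hz using proj_nonempty (hA.closed j) (hA.nonempty j)
  obtain ⟨w, hw, hzw⟩ := ultraUSC_proj (hA.closed j) 𝒰 id z y h𝒰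
    (Eventually.of_forall fun i => hz i)
  -- The reflector estimate with both arguments equal to `y` has right side zero, so any two nearest
  -- points to `y` agree.
  have hwa : w = a := by
    have h := hA.norm_refl_sub_refl_le (Lam_subset j hy) hy ⟨w, hw, rfl⟩ ⟨a, hya, rfl⟩
    rw [sub_self, norm_zero, mul_zero, norm_le_zero_iff, sub_eq_zero, sub_left_inj] at h
    exact smul_right_injective E (two_ne_zero (α := ℝ)) h
  rw [hwa] at hzw
  filter_upwards [hzw (hUo.mem_nhds haU), h𝒰 (hUo.mem_nhds (Lam_subset j hy))] with i hi hi'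
  exact ⟨mem_image ⟨(hz i).1, hi⟩ (hz i), hi'⟩

end Semicontinuity

/-! ### Gauges, their inverses and their iterates. -/

section Gauge

lemma IsGauge.surjective {ρ : ℝ≥0 → ℝ≥0} (hρ : IsGauge ρ) : Function.Surjective ρ := by
  refine hρ.continuous.surjective hρ.tendsto ?_
  -- On `ℝ≥0` the filter `atBot` is `pure 0`, so the condition at the lower end is just `ρ 0 = 0`.
  rw [OrderBot.atBot_eq]
  exact tendsto_pure_pure ρ ⊥ |>.trans_eq (congrArg pure hρ.zero)

lemma IsGauge.invFun_le {ρ : ℝ≥0 → ℝ≥0} (hρ : IsGauge ρ) {d r : ℝ≥0} (h : d ≤ ρ r) :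
    Function.invFun ρ d ≤ r := by
  rwa [← hρ.strictMono.le_iff_le, Function.rightInverse_invFun hρ.surjective d]

lemma IsGauge.exists_pos_lt {ρ : ℝ≥0 → ℝ≥0} (hρ : IsGauge ρ) {t : ℝ≥0} (ht : 0 < t) :
    ∃ s, 0 < s ∧ ρ s < t := by
  obtain ⟨s, hs⟩ := hρ.surjective (t / 2)
  refine ⟨s, ?_, ?_⟩
  · rw [← hρ.strictMono.lt_iff_lt, hρ.zero, hs]; positivity
  · rw [hs]; exact NNReal.half_lt_self ht.ne'

lemma IsGauge.iterate_zero {θ : ℝ≥0 → ℝ≥0} (hθ : IsGauge θ) (k : ℕ) : θ^[k] 0 = 0 :=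
  Function.iterate_fixed hθ.zero k

lemma IsGauge.iterate_pos {θ : ℝ≥0 → ℝ≥0} (hθ : IsGauge θ) (k : ℕ) {t : ℝ≥0} (ht : 0 < t) :
    0 < θ^[k] t := by
  simpa only [hθ.iterate_zero] using hθ.strictMono.iterate k ht

/-- If `∑ θ^(j)` is finite at some positive point, then it is arbitrarily small near `0`. -/
lemma IsGauge.exists_tsum_iterate_lt {θ : ℝ≥0 → ℝ≥0} (hθ : IsGauge θ) {s : ℝ≥0} (hs : 0 < s)
    (hsum : Summable fun j => θ^[j] s) {η : ℝ≥0} (hη : 0 < η) :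
    ∃ r, 0 < r ∧ ∀ t ≤ r, ∑' j, θ^[j] t < η := by
  -- A tail of the series at `s` is the whole series started at `θ^[N] s`, a positive threshold
  -- below which monotonicity gives the bound.
  obtain ⟨N, hN⟩ := ((NNReal.tendsto_sum_nat_add fun j => θ^[j] s).eventually_lt_const hη).exists
  simp only [Function.iterate_add_apply] at hN
  refine ⟨θ^[N] s, hθ.iterate_pos N hs, fun t ht => lt_of_le_of_lt ?_ hN⟩
  have hle : ∀ j, θ^[j] t ≤ θ^[j] (θ^[N] s) := fun j => hθ.strictMono.monotone.iterate j ht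
  have hS : Summable fun j => θ^[j] (θ^[N] s) := by
    simpa only [Function.iterate_add_apply] using (NNReal.summable_nat_add_iff N).2 hsum
  exact Summable.tsum_le_tsum hle (NNReal.summable_of_le hle hS) hS

/-- Since `d ≤ ρ r` means `ρ⁻¹ d ≤ r`, replacing `r` by `ρ⁻¹ d` subtracts less and weakens the
bound. -/
lemma le_theta {ρ : ℝ≥0 → ℝ≥0} (hρ : IsGauge ρ) {α ε : ℝ} (hα : 0 ≤ (1 - α) / α) {d r : ℝ≥0}
    (h : d ≤ ρ r) {p : ℝ≥0}
    (hp : (p : ℝ) ^ 2 ≤ (1 + ε) * (d : ℝ) ^ 2 - (1 - α) / α * (r : ℝ) ^ 2) :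
    p ≤ theta ρ α ε d := by
  unfold theta
  refine NNReal.le_toNNReal_of_coe_le (Real.le_sqrt_of_sq_le (hp.trans ?_))
  have : ((Function.invFun ρ d : ℝ≥0) : ℝ) ^ 2 ≤ (r : ℝ) ^ 2 :=
    pow_le_pow_left₀ (NNReal.coe_nonneg _) (NNReal.coe_le_coe.2 (hρ.invFun_le h)) 2
  have := mul_le_mul_of_nonneg_left this hα
  linarith

end Gauge

/-! ### Convergence of iterations, for an abstract set-valued map. -/

section Convergence

lemma IsIteration.mem {X : Type*} {T : X → Set X} {Λ : Set X} {x : ℕ → X}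
    (hx : IsIteration T x)
    (hstay : ∀ x ∈ Λ, ∀ xp ∈ T x, xp ∈ Λ) (h0 : x 0 ∈ Λ) (k : ℕ) : x k ∈ Λ := by
  induction k with
  | zero => exact h0
  | succ k ih => exact hstay _ ih _ (hx k)

variable {E : Type*} [NormedAddCommGroup E]

/-- Takes the infimum over `F` inside a square; nearest points in `F` may fail to exist, as `F` need
not be closed. -/
lemma le_mul_infDist_sq {F : Set E} (hF : F.Nonempty) {x : E} {a K : ℝ} (hK : 0 < K)
    (h : ∀ y ∈ F, a ≤ K * dist x y ^ 2) : a ≤ K * Metric.infDist x F ^ 2 := by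
  have h1 : √(a / K) ≤ Metric.infDist x F := by
    refine (Metric.le_infDist hF).2 fun y hy => ?_
    rw [Real.sqrt_le_left dist_nonneg, div_le_iff₀' hK]
    exact h y hy
  rwa [Real.sqrt_le_left Metric.infDist_nonneg, div_le_iff₀' hK] at h1

lemma mem_closure_of_infDist_le {F : Set E} (hF : F.Nonempty) {x : ℕ → E} {s : ℕ → ℝ} {xbar : E}
    (hx : Tendsto x atTop (𝓝 xbar)) (hs : Tendsto s atTop (𝓝 0))
    (h : ∀ k, Metric.infDist (x k) F ≤ s k) : xbar ∈ closure F := by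
  rw [Metric.mem_closure_iff_infDist_zero hF]
  refine le_antisymm ?_ Metric.infDist_nonneg
  exact le_of_tendsto_of_tendsto' ((Metric.continuous_infDist_pt F).continuousAt.tendsto.comp hx)
    hs h

lemma exists_lim_of_summable [CompleteSpace E] {F : Set E} (hF : F.Nonempty) {x : ℕ → E}
    {s : ℕ → ℝ} {C : ℝ} (hs : Summable s) (h : ∀ k, Metric.infDist (x k) F ≤ s k)
    (hstep : ∀ k, dist (x k) (x (k + 1)) ≤ C * s k) :
    ∃ xbar ∈ closure F, Tendsto x atTop (𝓝 xbar) ∧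
      ∀ k, dist (x k) xbar ≤ C * ∑' j, s (k + j) := by
  obtain ⟨xbar, hx⟩ := cauchySeq_tendsto_of_complete
    (cauchySeq_of_dist_le_of_summable _ hstep (hs.mul_left C))
  refine ⟨xbar, mem_closure_of_infDist_le hF hx hs.tendsto_atTop_zero h, hx, fun k => ?_⟩
  rw [← tsum_mul_left]
  exact dist_le_tsum_of_dist_le_of_tendsto _ hstep (hs.mul_left C) hx k

lemma FejerMonotone.dist_add_le {x : ℕ → E} {S : Set E} (hx : FejerMonotone x S) {y : E}
    (hy : y ∈ S) (k n : ℕ) : dist (x (k + n)) y ≤ dist (x k) y := by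
  induction n with
  | zero => exact le_rfl
  | succ n ih => exact (hx (k + n) y hy).trans ih

/-- For any `y ∈ F`, both `x k` and every later iterate lie within `dist (x k) y` of `y`; the
infimum over `y` gives the factor `2`. -/
lemma FejerMonotone.exists_lim [CompleteSpace E] {F : Set E} (hF : F.Nonempty) {x : ℕ → E}
    (hx : FejerMonotone x F) {s : ℕ → ℝ} (hs : Tendsto s atTop (𝓝 0))
    (h : ∀ k, Metric.infDist (x k) F ≤ s k) :
    ∃ xbar ∈ closure F, Tendsto x atTop (𝓝 xbar) ∧ (∀ k, dist (x k) xbar ≤ 2 * s k) ∧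
      ∀ y ∈ F, dist xbar y ≤ dist (x 0) y := by
  have key : ∀ k n, k ≤ n → dist (x k) (x n) ≤ 2 * s k := by
    intro k n hkn
    obtain ⟨n, rfl⟩ := Nat.exists_eq_add_of_le hkn
    have : dist (x k) (x (k + n)) / 2 ≤ Metric.infDist (x k) F := by
      refine (Metric.le_infDist hF).2 fun y hy => ?_
      have h1 := hx.dist_add_le hy k n
      have h2 := dist_triangle_right (x k) (x (k + n)) y
      linarith
    linarith [h k]
  have hc : CauchySeq x := by
    refine cauchySeq_of_le_tendsto_0 (fun k => 2 * s k + 2 * s k) (fun n p N hn hp => ?_) ?_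
    · exact (dist_triangle_left _ _ (x N)).trans (add_le_add (key N n hn) (key N p hp))
    · simpa using (hs.const_mul 2).add (hs.const_mul 2)
  obtain ⟨xbar, hxb⟩ := cauchySeq_tendsto_of_complete hc
  refine ⟨xbar, mem_closure_of_infDist_le hF hxb hs h, hxb, fun k => ?_, fun y hy => ?_⟩
  · exact le_of_tendsto (tendsto_const_nhds.dist hxb) (eventually_atTop.2 ⟨k, key k⟩)
  · exact le_of_tendsto (hxb.dist tendsto_const_nhds)
      (Eventually.of_forall fun n => by simpa using hx.dist_add_le hy 0 n)

/-- A property that holds on a ball around every point of `F` holds on an open superset. -/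
lemma exists_open_superset {F : Set E} {P : E → Prop}
    (h : ∀ y ∈ F, ∃ r > 0, ∀ v, dist v y < r → P v) : ∃ V, IsOpen V ∧ F ⊆ V ∧ ∀ v ∈ V, P v := by
  choose! r hr hP using h
  refine ⟨⋃ y ∈ F, Metric.ball y (r y), isOpen_biUnion fun _ _ => Metric.isOpen_ball,
    fun y hy => Set.mem_biUnion hy (Metric.mem_ball_self (hr y hy)), fun v hv => ?_⟩
  obtain ⟨y, hy, hv⟩ := Set.mem_iUnion₂.1 hv
  exact hP y hy v hv

variable {T : E → Set E} {F Λ Z W : Set E} {ρ θ : ℝ≥0 → ℝ≥0} {C : ℝ≥0}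

lemma IsIteration.infNndist_le_iterate {x : ℕ → E} (hx : IsIteration T x)
    (hstay : ∀ x ∈ Λ, ∀ xp ∈ T x, xp ∈ Λ) (h0 : x 0 ∈ Λ) (hθ : Monotone θ)
    (hd : ∀ x ∈ Λ, ∀ xp ∈ T x, Metric.infNndist xp F ≤ θ (Metric.infNndist x F)) (k : ℕ) :
    Metric.infNndist (x k) F ≤ θ^[k] (Metric.infNndist (x 0) F) := by
  induction k with
  | zero => exact le_rfl
  | succ k ih =>
    rw [Function.iterate_succ_apply']
    exact (hd _ (hx.mem hstay h0 k) _ (hx k)).trans (hθ ih)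

/-- Turns closeness to `Z`, later `Fix T ∩ U_1`, into closeness to the smaller set `F`, where the
assumptions on `θ` apply. -/
lemma exists_pos_forall_infNndist_lt (hρ : IsGauge ρ) (hZ : Z.Nonempty)
    (hnear : ∀ x ∈ Λ, ∀ xp ∈ T x, ∀ z ∈ Z, Metric.infNndist x F ≤ ρ (C * nndist x z))
    {t : ℝ≥0} (ht : 0 < t) :
    ∃ δ : ℝ, 0 < δ ∧ ∀ x ∈ Λ, ∀ xp ∈ T x, Metric.infDist x Z < δ → Metric.infNndist x F < t := by
  obtain ⟨s, hs, hst⟩ := hρ.exists_pos_lt ht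
  -- `C + 1` rather than `C` avoids dividing by zero.
  refine ⟨((s / (C + 1) : ℝ≥0) : ℝ), NNReal.coe_pos.2 (by positivity), fun x hx xp hxp h => ?_⟩
  obtain ⟨z, hz, hxz⟩ := (Metric.infDist_lt_iff hZ).1 h
  refine (hnear x hx xp hxp z hz).trans_lt (lt_of_le_of_lt (hρ.strictMono.monotone ?_) hst)
  have h1 : nndist x z ≤ s / (C + 1) := by
    rw [← NNReal.coe_le_coe, coe_nndist]; exact hxz.le
  calc C * nndist x z ≤ (C + 1) * (s / (C + 1)) := by gcongr; exact le_self_add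
    _ = s := by field_simp

/-- `V` is a union of balls contained in `Λ` and centred in `F`: by Fejér monotonicity the limit is
no farther from the centre than the start. -/
lemma fejer_convergence [CompleteSpace E] (hF : F.Nonempty) (hFix : closure F ⊆ Fix T)
    (hFT : F ⊆ Fix T) (hFΛ : F ⊆ Λ) (hΛ : IsOpen Λ) (hstay : ∀ x ∈ Λ, ∀ xp ∈ T x, xp ∈ Λ)
    (hd : ∀ x ∈ Λ, ∀ xp ∈ T x, Metric.infNndist xp F ≤ θ (Metric.infNndist x F))
    (hρ : IsGauge ρ) (hZ : Z.Nonempty)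
    (hnear : ∀ x ∈ Λ, ∀ xp ∈ T x, ∀ z ∈ Z, Metric.infNndist x F ≤ ρ (C * nndist x z))
    (hθ : IsGauge θ) {tbar : ℝ≥0} (htbar : 0 < tbar)
    (hlim : ∀ t, 0 < t → t < tbar → Tendsto (fun k => θ^[k] t) atTop (𝓝 0)) :
    ∃ δ : ℝ, 0 < δ ∧ ∃ V : Set E, IsOpen V ∧ F ⊆ V ∧
      ∀ x : ℕ → E, IsIteration T x → x 0 ∈ Λ → Metric.infDist (x 0) Z < δ →
        FejerMonotone x (Fix T) →
        ∃ xbar ∈ Fix T, Tendsto x atTop (𝓝 xbar) ∧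
          (fun k => dist (x k) xbar) =O[atTop]
            (fun k => ((θ^[k] (Metric.infNndist (x 0) F) : ℝ≥0) : ℝ)) ∧
          (x 0 ∈ V → xbar ∈ Fix T ∩ Λ) := by
  obtain ⟨δ, hδ, hδt⟩ := exists_pos_forall_infNndist_lt hρ hZ hnear htbar
  obtain ⟨V, hV, hFV, hVP⟩ := exists_open_superset (F := F)
    (P := fun v => ∃ y ∈ F, ∀ w, dist w y ≤ dist v y → w ∈ Λ) fun y hy => by
      obtain ⟨R, hR, hb⟩ := Metric.isOpen_iff.1 hΛ y (hFΛ hy)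
      exact ⟨R, hR, fun v hv => ⟨y, hy, fun w hw => hb (hw.trans_lt hv)⟩⟩
  refine ⟨δ, hδ, V, hV, hFV, fun x hx h0 hxδ hfej => ?_⟩
  have ht := hδt _ h0 _ (hx 0) hxδ
  have hs : Tendsto (fun k => θ^[k] (Metric.infNndist (x 0) F)) atTop (𝓝 0) := by
    rcases eq_zero_or_pos (Metric.infNndist (x 0) F) with h | h
    · simp only [h, hθ.iterate_zero, tendsto_const_nhds]
    · exact hlim _ h ht
  obtain ⟨xbar, hcl, hlimx, hb, hy⟩ := FejerMonotone.exists_lim hF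
    (fun k y hy => hfej k y (hFT hy)) (NNReal.tendsto_coe.2 hs)
    (fun k => NNReal.coe_le_coe.2 (hx.infNndist_le_iterate hstay h0 hθ.strictMono.monotone hd k))
  refine ⟨xbar, hFix hcl, hlimx, IsBigO.of_bound 2 (Eventually.of_forall fun k => ?_),
    fun h => ?_⟩
  · rw [Real.norm_of_nonneg dist_nonneg, Real.norm_of_nonneg (NNReal.coe_nonneg _)]
    exact hb k
  · obtain ⟨y, hyF, hw⟩ := hVP _ h
    exact ⟨hFix hcl, hw _ (hy y hyF)⟩

/-- Step lengths are at most `C * θ^[k] t₀`, so summability replaces Fejér monotonicity. `V`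
consists of points from which the total path length is too short to leave `Λ`. -/
lemma summable_convergence [CompleteSpace E] (hF : F.Nonempty) (hFix : closure F ⊆ Fix T)
    (hFΛ : F ⊆ Λ) (hΛ : IsOpen Λ) (hstay : ∀ x ∈ Λ, ∀ xp ∈ T x, xp ∈ Λ)
    (hd : ∀ x ∈ Λ, ∀ xp ∈ T x, Metric.infNndist xp F ≤ θ (Metric.infNndist x F))
    (hmove : ∀ x ∈ Λ, ∀ xp ∈ T x, dist x xp ≤ C * Metric.infDist x F)
    (hρ : IsGauge ρ) (hZ : Z.Nonempty)
    (hnear : ∀ x ∈ Λ, ∀ xp ∈ T x, ∀ z ∈ Z, Metric.infNndist x F ≤ ρ (C * nndist x z))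
    (hθ : IsGauge θ) {tbar : ℝ≥0} (htbar : 0 < tbar)
    (hsum : ∀ t, 0 < t → t < tbar → Summable (fun j : ℕ => θ^[j + 1] t)) :
    ∃ δ : ℝ, 0 < δ ∧ ∃ V : Set E, IsOpen V ∧ F ⊆ V ∧
      ∀ x : ℕ → E, IsIteration T x → x 0 ∈ Λ → Metric.infDist (x 0) Z < δ →
        ∃ xbar ∈ Fix T, Tendsto x atTop (𝓝 xbar) ∧
          (fun k => dist (x k) xbar) =O[atTop]
            (fun k => ((∑' j : ℕ, θ^[k + j] (Metric.infNndist (x 0) F) : ℝ≥0) : ℝ)) ∧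
          (x 0 ∈ V → xbar ∈ Fix T ∩ Λ) := by
  have hsum' : ∀ t < tbar, Summable fun j : ℕ => θ^[j] t := by
    intro t ht
    rcases eq_zero_or_pos t with h | h
    · simp only [h, hθ.iterate_zero, summable_zero]
    · exact (NNReal.summable_nat_add_iff 1).1 (hsum t h ht)
  obtain ⟨δ, hδ, hδt⟩ := exists_pos_forall_infNndist_lt hρ hZ hnear htbar
  obtain ⟨V, hV, hFV, hVP⟩ := exists_open_superset (F := F)
    (P := fun v => ∀ w, dist v w ≤ C * ∑' j, ((θ^[j] (Metric.infNndist v F) : ℝ≥0) : ℝ) → w ∈ Λ)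
    fun y hy => by
      obtain ⟨R, hR, hb⟩ := Metric.isOpen_iff.1 hΛ y (hFΛ hy)
      have hη : 0 < Real.toNNReal (R / 2 / (C + 1)) := Real.toNNReal_pos.2 (by positivity)
      -- Half of `R` is spent on the distance from `v` to `y`, half on the path. The point `tbar /
      -- 2` is used because summability is only known strictly below `tbar`.
      obtain ⟨r, hr, hrη⟩ := hθ.exists_tsum_iterate_lt (half_pos htbar)
        (hsum' _ (NNReal.half_lt_self htbar.ne')) hη
      refine ⟨min r (R / 2), lt_min (NNReal.coe_pos.2 hr) (half_pos hR), fun v hv w hw => hb ?_⟩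
      have h1 : Metric.infNndist v F ≤ r := by
        rw [← NNReal.coe_le_coe]
        exact (Metric.infDist_le_dist_of_mem hy).trans (hv.le.trans (min_le_left _ _))
      have h2 := (Real.lt_toNNReal_iff_coe_lt).1 (hrη _ h1)
      rw [NNReal.coe_tsum, lt_div_iff₀ (by positivity)] at h2
      have h3 : 0 ≤ ∑' j, ((θ^[j] (Metric.infNndist v F) : ℝ≥0) : ℝ) :=
        tsum_nonneg fun j => NNReal.coe_nonneg _
      have h4 := dist_triangle_left w y v
      have h5 := hv.trans_le (min_le_right _ _)
      rw [Metric.mem_ball]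
      linarith
  refine ⟨δ, hδ, V, hV, hFV, fun x hx h0 hxδ => ?_⟩
  have hs := NNReal.summable_coe.2 (hsum' _ (hδt _ h0 _ (hx 0) hxδ))
  have hk : ∀ k, Metric.infDist (x k) F ≤ ((θ^[k] (Metric.infNndist (x 0) F) : ℝ≥0) : ℝ) :=
    fun k => NNReal.coe_le_coe.2
      (hx.infNndist_le_iterate hstay h0 hθ.strictMono.monotone hd k)
  obtain ⟨xbar, hcl, hlimx, hb⟩ := exists_lim_of_summable hF hs hk fun k =>
    (hmove _ (hx.mem hstay h0 k) _ (hx k)).trans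
      (mul_le_mul_of_nonneg_left (hk k) C.coe_nonneg)
  refine ⟨xbar, hFix hcl, hlimx, IsBigO.of_bound C (Eventually.of_forall fun k => ?_),
    fun h => ⟨hFix hcl, hVP _ h _ (by simpa using hb 0)⟩⟩
  rw [Real.norm_of_nonneg dist_nonneg, Real.norm_of_nonneg (NNReal.coe_nonneg _),
    NNReal.coe_tsum]
  exact hb k

/-- An iteration that contracts the distance to `F` on `W` and starts close to a point of `W`
never leaves `W`. -/
lemma IsIteration.mem_and_infDist_le {c : ℝ} (hc0 : 0 ≤ c) (hc1 : c < 1)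
    (hstay : ∀ x ∈ Λ, ∀ xp ∈ T x, xp ∈ Λ)
    (hmove : ∀ x ∈ Λ, ∀ xp ∈ T x, dist x xp ≤ C * Metric.infDist x F)
    (hstep : ∀ x ∈ Λ, x ∈ W → ∀ xp ∈ T x, Metric.infDist xp F ≤ c * Metric.infDist x F)
    {x : ℕ → E} (hx : IsIteration T x) (h0 : x 0 ∈ Λ) {z : E} {R : ℝ}
    (hW : Metric.ball z R ⊆ W)
    (hR : dist (x 0) z + C * Metric.infDist (x 0) F / (1 - c) < R) (k : ℕ) :
    x k ∈ W ∧ Metric.infDist (x k) F ≤ c ^ k * Metric.infDist (x 0) F := by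
  have hc : 0 < 1 - c := by linarith
  have hd0 : 0 ≤ C * Metric.infDist (x 0) F := mul_nonneg C.coe_nonneg Metric.infDist_nonneg
  -- The factor `1 - c ^ k` is the partial geometric sum times `1 - c`. The two bounds keep `x k` in
  -- `W`, which licenses the next contraction.
  have main : ∀ k, dist (x 0) (x k) * (1 - c) ≤ C * Metric.infDist (x 0) F * (1 - c ^ k) ∧
      Metric.infDist (x k) F ≤ c ^ k * Metric.infDist (x 0) F → x k ∈ W := by
    rintro k ⟨h1, -⟩
    apply hW
    have h2 : dist (x 0) (x k) ≤ C * Metric.infDist (x 0) F / (1 - c) := by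
      rw [le_div_iff₀ hc]
      nlinarith [pow_nonneg hc0 k]
    rw [Metric.mem_ball]
    linarith [dist_triangle_left (x k) z (x 0)]
  have key : dist (x 0) (x k) * (1 - c) ≤ C * Metric.infDist (x 0) F * (1 - c ^ k) ∧
      Metric.infDist (x k) F ≤ c ^ k * Metric.infDist (x 0) F := by
    induction k with
    | zero => simp
    | succ k ih =>
      have hΛk := hx.mem hstay h0 k
      have h1 := hmove _ hΛk _ (hx k)
      have h2 := hstep _ hΛk (main k ih) _ (hx k)
      have h3 := dist_triangle (x 0) (x k) (x (k + 1))
      have h4 := mul_le_mul_of_nonneg_left ih.2 C.coe_nonneg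
      constructor
      · have h5 := mul_le_mul_of_nonneg_right (h3.trans (add_le_add le_rfl (h1.trans h4))) hc.le
        rw [pow_succ]
        nlinarith [ih.1]
      · rw [pow_succ', mul_assoc]
        exact h2.trans (mul_le_mul_of_nonneg_left ih.2 hc0)
  exact ⟨main k key, key.2⟩

/-- Near `z ∈ Z ∩ W` the initial distance to `F` is at most `K * dist (x 0) z`, so the whole
geometric path fits in a ball about `z` inside `W`. Such starts form `N`. -/
lemma linear_convergence [CompleteSpace E] (hF : F.Nonempty) (hFix : closure F ⊆ Fix T)
    (hFΛ : F ⊆ Λ) (hΛ : IsOpen Λ) (hstay : ∀ x ∈ Λ, ∀ xp ∈ T x, xp ∈ Λ)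
    (hmove : ∀ x ∈ Λ, ∀ xp ∈ T x, dist x xp ≤ C * Metric.infDist x F)
    {K : ℝ≥0} (hnear : ∀ x ∈ Λ, ∀ xp ∈ T x, ∀ z ∈ Z, Metric.infDist x F ≤ K * dist x z)
    (hW : IsOpen W) {c : ℝ} (hc0 : 0 ≤ c) (hc1 : c < 1)
    (hstep : ∀ x ∈ Λ, x ∈ W → ∀ xp ∈ T x, Metric.infDist xp F ≤ c * Metric.infDist x F) :
    ∃ N V : Set E, IsOpen N ∧ Z ∩ W ⊆ N ∧ IsOpen V ∧ F ⊆ V ∧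
      ∀ x : ℕ → E, IsIteration T x → x 0 ∈ Λ → x 0 ∈ N →
        (∀ k, Metric.infDist (x (k + 1)) F ≤ c * Metric.infDist (x k) F) ∧
        ∃ xbar ∈ Fix T, RLinear x xbar c ∧ (x 0 ∈ V → xbar ∈ Fix T ∩ Λ) := by
  have hc : 0 < 1 - c := by linarith
  obtain ⟨N, hN, hZN, hNP⟩ := exists_open_superset (F := Z ∩ W)
    (P := fun v => ∃ z ∈ Z, ∃ R, Metric.ball z R ⊆ W ∧
      dist v z + C * (K * dist v z) / (1 - c) < R) fun z hz => by
      obtain ⟨R, hR, hb⟩ := Metric.isOpen_iff.1 hW z hz.2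
      have hpos : 0 < 1 + C * K / (1 - c) := by positivity
      refine ⟨R / (1 + C * K / (1 - c)), by positivity, fun v hv => ⟨z, hz.1, R, hb, ?_⟩⟩
      rw [lt_div_iff₀ hpos] at hv
      refine lt_of_eq_of_lt ?_ hv
      ring
  obtain ⟨V, hV, hFV, hVP⟩ := exists_open_superset (F := F)
    (P := fun v => ∀ w, dist v w ≤ C * (Metric.infDist v F / (1 - c)) → w ∈ Λ) fun y hy => by
      obtain ⟨R, hR, hb⟩ := Metric.isOpen_iff.1 hΛ y (hFΛ hy)
      have hpos : 0 < 1 + C / (1 - c) := by positivity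
      refine ⟨R / (1 + C / (1 - c)), by positivity, fun v hv w hw => hb ?_⟩
      rw [lt_div_iff₀ hpos] at hv
      have h1 : C * (Metric.infDist v F / (1 - c)) ≤ C * (dist v y / (1 - c)) := by
        gcongr; exact Metric.infDist_le_dist_of_mem hy
      have h2 : dist v y * (1 + C / (1 - c)) = dist v y + C * (dist v y / (1 - c)) := by ring
      rw [Metric.mem_ball]
      linarith [dist_triangle_left w y v]
  refine ⟨N, V, hN, hZN, hV, hFV, fun x hx h0 hxN => ?_⟩
  obtain ⟨z, hz, R, hb, hR⟩ := hNP _ hxN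
  have hR' : dist (x 0) z + C * Metric.infDist (x 0) F / (1 - c) < R := by
    refine lt_of_le_of_lt ?_ hR
    gcongr
    exact hnear _ h0 _ (hx 0) z hz
  have key := hx.mem_and_infDist_le hc0 hc1 hstay hmove hstep h0 hb hR'
  have hs : Summable fun k => c ^ k * Metric.infDist (x 0) F :=
    (summable_geometric_of_lt_one hc0 hc1).mul_right _
  obtain ⟨xbar, hcl, -, hbd⟩ := exists_lim_of_summable hF hs (fun k => (key k).2) fun k =>
    (hmove _ (hx.mem hstay h0 k) _ (hx k)).trans
      (mul_le_mul_of_nonneg_left (key k).2 C.coe_nonneg)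
  have htsum : ∀ k, ∑' j, c ^ (k + j) * Metric.infDist (x 0) F
      = c ^ k * (Metric.infDist (x 0) F / (1 - c)) := by
    intro k
    simp_rw [pow_add, mul_assoc]
    rw [tsum_mul_left, tsum_mul_right, tsum_geometric_of_lt_one hc0 hc1]
    ring
  simp only [htsum] at hbd
  refine ⟨fun k => hstep _ (hx.mem hstay h0 k) (key k).1 _ (hx k), xbar, hFix hcl,
    ⟨hc0, hc1, C * (Metric.infDist (x 0) F / (1 - c)), fun k => (hbd k).trans_eq (by ring)⟩,
    fun h => ⟨hFix hcl, hVP _ h _ (by simpa using hbd 0)⟩⟩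

end Convergence

end CDR

/-! ### The theorem: the averaging inequality combined with metric subregularity. -/

theorem theorem4p6 {E : Type*} [NormedAddCommGroup E] [InnerProductSpace ℝ E]
    [FiniteDimensional ℝ E] (m : ℕ) [NeZero m] (hm : 2 ≤ m)
    (A U : Fin m → Set E) (lam : ℝ) (hlam0 : 0 ≤ lam) (hlam1 : lam ≤ 1)
    (e : Fin m → ℝ) (T : E → Set E) (hT : T = CDR.cyclicDR lam A)
    (F : Set E) (hF : F = CDR.Fix T ∩ CDR.Lam A U 0)
    (hfix : (CDR.Fix T ∩ U 0).Nonempty)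
    (hA : CDR.Standing lam A U e)
    (ρ : ℝ≥0 → ℝ≥0) (hρ : CDR.IsGauge ρ)
    (hsub : CDR.MetricSubregular T F (U 0 ∩ CDR.Lam A U 0) ρ)
    (θ : ℝ≥0 → ℝ≥0)
    (hθ : θ = CDR.theta ρ (CDR.averaging m) (CDR.violation lam e)) :
    -- one step estimate
    (∀ x ∈ U 0 ∩ CDR.Lam A U 0, ∀ xp ∈ T x,
      Metric.infNndist xp F ≤ θ (Metric.infNndist x F)) ∧
    -- convergence with a rate given by the gauge
    (∀ tbar : ℝ≥0, CDR.ThetaAdmissible θ tbar →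
      ((∀ t, 0 < t → t < tbar → Tendsto (fun k => θ^[k] t) atTop (𝓝 0)) →
        ∃ δ : ℝ, 0 < δ ∧ ∃ V : Set E, IsOpen V ∧ F ⊆ V ∧
          ∀ x : ℕ → E, CDR.IsIteration T x → x 0 ∈ CDR.Lam A U 0 →
            Metric.infDist (x 0) (CDR.Fix T ∩ U 0) < δ →
            CDR.FejerMonotone x (CDR.Fix T) →
            ∃ xbar ∈ CDR.Fix T, Tendsto x atTop (𝓝 xbar) ∧
              (fun k => dist (x k) xbar) =O[atTop]
                (fun k => ((θ^[k] (Metric.infNndist (x 0) F) : ℝ≥0) : ℝ)) ∧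
              (x 0 ∈ V → xbar ∈ CDR.Fix T ∩ CDR.Lam A U 0)) ∧
      ((∀ t, 0 < t → t < tbar → Summable (fun j : ℕ => θ^[j + 1] t)) →
        ∃ δ : ℝ, 0 < δ ∧ ∃ V : Set E, IsOpen V ∧ F ⊆ V ∧
          ∀ x : ℕ → E, CDR.IsIteration T x → x 0 ∈ CDR.Lam A U 0 →
            Metric.infDist (x 0) (CDR.Fix T ∩ U 0) < δ →
            ∃ xbar ∈ CDR.Fix T, Tendsto x atTop (𝓝 xbar) ∧
              (fun k => dist (x k) xbar) =O[atTop]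
                (fun k => ((∑' j : ℕ, θ^[k + j] (Metric.infNndist (x 0) F) : ℝ≥0) : ℝ)) ∧
              (x 0 ∈ V → xbar ∈ CDR.Fix T ∩ CDR.Lam A U 0))) ∧
    -- linear gauge and arbitrarily small violation
    (∀ (α : ℝ) (κ : ℝ≥0) (W : ℝ → Set E), 0 < κ → (∀ t, ρ t = κ * t) →
      0 < α → α < 1 →
      (∀ ε : ℝ, 0 < ε → ε < 1 →
        IsOpen (W ε) ∧ ∀ y ∈ F, CDR.PointwiseAFNE T (W ε) y α ε) →
      ∀ ε : ℝ, 0 < ε → ε < 1 → ε < (1 - α) / ((κ : ℝ) ^ 2 * α) →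
        ∀ c : ℝ, c = √(1 + ε - (1 - α) / ((κ : ℝ) ^ 2 * α)) →
        c < 1 ∧
        ∃ N V : Set E, IsOpen N ∧ CDR.Fix T ∩ U 0 ∩ W ε ⊆ N ∧ IsOpen V ∧ F ⊆ V ∧
          ∀ x : ℕ → E, CDR.IsIteration T x → x 0 ∈ CDR.Lam A U 0 → x 0 ∈ N →
            (∀ k, Metric.infDist (x (k + 1)) F ≤ c * Metric.infDist (x k) F) ∧
            ∃ xbar ∈ CDR.Fix T, CDR.RLinear x xbar c ∧
              (x 0 ∈ V → xbar ∈ CDR.Fix T ∩ CDR.Lam A U 0)) := by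
  subst hT hF
  have hm : (0 : ℝ) < m := Nat.cast_pos.2 (by omega)
  have hq : (1 - CDR.averaging m) / CDR.averaging m = 1 / (m : ℝ) := by
    unfold CDR.averaging; field_simp; ring
  have hε := hA.violation_nonneg hlam0
  set T := CDR.cyclicDR lam A with hT
  set Λ := CDR.Lam A U 0 with hΛdef
  set ε := CDR.violation lam e with hεdef
  set F := CDR.Fix T ∩ Λ with hF
  have hΛU : Λ ⊆ U 0 := CDR.Lam_subset 0
  have havg {x y xp yp : E} (hx : x ∈ U 0) (hy : y ∈ Λ) (hxp : xp ∈ T x) (hyp : yp ∈ T y) :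
      yp ∈ Λ ∧ ‖xp - yp‖ ^ 2 ≤ (1 + ε) * ‖x - y‖ ^ 2
        - 1 / (m : ℝ) * ‖(xp - x) - (yp - y)‖ ^ 2 := by
    have h := hA.norm_cyclicDR_sub_sq_le hlam0 hlam1 hx hy hxp hyp
    rwa [hq] at h
  have hstay : ∀ x ∈ Λ, ∀ xp ∈ T x, xp ∈ Λ := fun x hx xp hxp =>
    (havg (hΛU hx) hx hxp hxp).1
  have hFne : F.Nonempty := by
    obtain ⟨c, hcA, -, hcU, -⟩ := hA.superRegular 0
    -- The centre of `U_1` is its own nearest point in `A_1`, so subregularity applies there; the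
    -- finite right side excludes an empty `F`.
    have hcΛ : c ∈ Λ := ⟨CDR.mem_image ⟨hcA, hcU⟩ ⟨hcA, fun b _ => by simp⟩, hcU⟩
    by_contra h
    have h1 := hsub c ⟨hcU, hcΛ⟩
    rw [Set.not_nonempty_iff_eq_empty.1 h, Metric.infEDist_empty] at h1
    exact absurd h1 (by simp)
  have hsub' : ∀ x ∈ Λ, ∀ xp ∈ T x, Metric.infNndist x F ≤ ρ (nndist x xp) := by
    intro x hx xp hxp
    have h1 : Metric.infNndist x F ≤ ρ (Metric.infNndist x (T x)) :=
      by
      simpa [Metric.infNndist] using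
        ENNReal.toNNReal_mono ENNReal.coe_ne_top (hsub x ⟨hΛU hx, hx⟩)
    refine h1.trans (hρ.strictMono.monotone ?_)
    rw [← NNReal.coe_le_coe, coe_nndist, Metric.coe_infNndist]
    exact Metric.infDist_le_dist_of_mem hxp
  have hmoveF : ∀ x ∈ Λ, ∀ xp ∈ T x, dist xp x ^ 2 ≤ m * (1 + ε) * Metric.infDist x F ^ 2 := by
    intro x hx xp hxp
    refine CDR.le_mul_infDist_sq hFne (by positivity) fun y hy => ?_
    have h := (havg (hΛU hx) hy.2 hxp hy.1).2
    rw [sub_self, sub_zero, ← dist_eq_norm, ← dist_eq_norm, ← dist_eq_norm] at h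
    have h1 : 1 / (m : ℝ) * dist xp x ^ 2 ≤ (1 + ε) * dist x y ^ 2 := by
      linarith [sq_nonneg (dist xp y)]
    rw [one_div_mul_eq_div, div_le_iff₀ hm] at h1
    linarith
  have hmoveZ : ∀ x ∈ Λ, ∀ xp ∈ T x, ∀ z ∈ CDR.Fix T ∩ U 0,
      dist xp x ^ 2 ≤ m * (1 + ε) * dist x z ^ 2 := by
    intro x hx xp hxp z hz
    -- Roles are exchanged: the base point is the iterate `x ∈ Λ`, since `z` is only known to lie in
    -- `U 0`.
    have h := (havg hz.2 hx hz.1 hxp).2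
    rw [sub_self, zero_sub, norm_neg, ← dist_eq_norm, ← dist_eq_norm, ← dist_eq_norm,
      dist_comm z x] at h
    have h1 : 1 / (m : ℝ) * dist xp x ^ 2 ≤ (1 + ε) * dist x z ^ 2 := by
      linarith [sq_nonneg (dist z xp)]
    rw [one_div_mul_eq_div, div_le_iff₀ hm] at h1
    linarith
  set C : ℝ≥0 := Real.toNNReal √(m * (1 + ε)) with hC
  have hCcoe : (C : ℝ) = √(m * (1 + ε)) := Real.coe_toNNReal _ (Real.sqrt_nonneg _)
  have hCle {a b : ℝ} (hb : 0 ≤ b) (h : a ^ 2 ≤ m * (1 + ε) * b ^ 2) : a ≤ C * b := by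
    rw [hCcoe]
    apply le_of_sq_le_sq _ (by positivity)
    rwa [mul_pow, Real.sq_sqrt (by positivity)]
  have hmove : ∀ x ∈ Λ, ∀ xp ∈ T x, dist x xp ≤ C * Metric.infDist x F :=
    fun x hx xp hxp => hCle Metric.infDist_nonneg (dist_comm xp x ▸ hmoveF x hx xp hxp)
  have hnear : ∀ x ∈ Λ, ∀ xp ∈ T x, ∀ z ∈ CDR.Fix T ∩ U 0,
      Metric.infNndist x F ≤ ρ (C * nndist x z) := by
    intro x hx xp hxp z hz
    refine (hsub' x hx xp hxp).trans (hρ.strictMono.monotone ?_)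
    rw [← NNReal.coe_le_coe, NNReal.coe_mul, coe_nndist, coe_nndist]
    exact hCle dist_nonneg (dist_comm xp x ▸ hmoveZ x hx xp hxp z hz)
  have hd : ∀ x ∈ Λ, ∀ xp ∈ T x, Metric.infNndist xp F ≤ θ (Metric.infNndist x F) := by
    intro x hx xp hxp
    rw [hθ]
    refine CDR.le_theta hρ (by rw [hq]; positivity) (hsub' x hx xp hxp) ?_
    rw [hq, Metric.coe_infNndist, Metric.coe_infNndist, coe_nndist, le_sub_iff_add_le]
    refine CDR.le_mul_infDist_sq hFne (by positivity) fun y hy => ?_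
    have h := (havg (hΛU hx) hy.2 hxp hy.1).2
    rw [sub_self, sub_zero, ← dist_eq_norm, ← dist_eq_norm, ← dist_eq_norm,
      dist_comm xp x] at h
    have h1 : Metric.infDist xp F ^ 2 ≤ dist xp y ^ 2 :=
      pow_le_pow_left₀ Metric.infDist_nonneg (Metric.infDist_le_dist_of_mem hy) 2
    linarith
  have hFix : closure F ⊆ CDR.Fix T :=
    closure_minimal Set.inter_subset_left (CDR.ultraUSC_cyclicDR hA.closed lam).isClosed_Fix
  have hΛo : IsOpen Λ := hA.isOpen_Lam 0
  have hcomplete : CompleteSpace E := FiniteDimensional.complete ℝ E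
  refine ⟨fun x hx => hd x hx.2, fun tbar htbar => ⟨fun hlim => ?_, fun hsum => ?_⟩, ?_⟩
  · exact CDR.fejer_convergence hFne hFix Set.inter_subset_left Set.inter_subset_right hΛo hstay
      hd hρ hfix hnear htbar.2.1 htbar.1 hlim
  · exact CDR.summable_convergence hFne hFix Set.inter_subset_right hΛo hstay
      hd hmove hρ hfix hnear htbar.2.1 htbar.1 hsum
  · intro α κ W hκ hρκ hα0 hα1 hW ε' hε0 hε1 hεlt c hc
    have hκ' : (0 : ℝ) < κ := NNReal.coe_pos.2 hκ
    have hα1' : 0 < 1 - α := by linarith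
    have hc0 : 0 ≤ c := hc ▸ Real.sqrt_nonneg _
    have hc1 : c < 1 := by
      rw [hc, Real.sqrt_lt' one_pos]; linarith
    refine ⟨hc1, CDR.linear_convergence (K := κ * C) hFne hFix Set.inter_subset_right hΛo hstay
      hmove (fun x hx xp hxp z hz => ?_) (hW ε' hε0 hε1).1 hc0 hc1 fun x hx hxW xp hxp => ?_⟩
    · have h := NNReal.coe_le_coe.2 (hnear x hx xp hxp z hz)
      rwa [hρκ, ← mul_assoc, NNReal.coe_mul, coe_nndist] at h
    · have h1 : Metric.infDist x F ≤ κ * dist x xp := by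
        have h := NNReal.coe_le_coe.2 (hsub' x hx xp hxp)
        rwa [hρκ, NNReal.coe_mul, coe_nndist] at h
      have h2 : Metric.infDist xp F ^ 2 + (1 - α) / α * dist x xp ^ 2
          ≤ (1 + ε') * Metric.infDist x F ^ 2 := by
        refine CDR.le_mul_infDist_sq hFne (by positivity) fun y hy => ?_
        -- Among the values of `T y` the fixed point `y` itself is chosen, so its displacement
        -- vanishes.
        have h := ((hW ε' hε0 hε1).2 y hy).2.2.2.2.2 x hxW xp hxp y hy.1
        rw [sub_self, sub_zero, ← dist_eq_norm, ← dist_eq_norm, ← dist_eq_norm,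
          dist_comm xp x] at h
        have h1 : Metric.infDist xp F ^ 2 ≤ dist xp y ^ 2 :=
          pow_le_pow_left₀ Metric.infDist_nonneg (Metric.infDist_le_dist_of_mem hy) 2
        linarith
      have h3 : (1 - α) / ((κ : ℝ) ^ 2 * α) * Metric.infDist x F ^ 2
          ≤ (1 - α) / α * dist x xp ^ 2 := by
        have h := mul_le_mul_of_nonneg_left (pow_le_pow_left₀ Metric.infDist_nonneg h1 2)
          (show 0 ≤ (1 - α) / ((κ : ℝ) ^ 2 * α) by positivity)
        refine h.trans_eq ?_
        field_simp
      -- Only an inequality, because a negative radicand is truncated to `0` in `c`.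
      have h4 : 1 + ε' - (1 - α) / ((κ : ℝ) ^ 2 * α) ≤ c ^ 2 := by
        rw [← Real.sqrt_le_left hc0, hc]
      have h5 := mul_le_mul_of_nonneg_right h4 (sq_nonneg (Metric.infDist x F))
      apply le_of_sq_le_sq _ (mul_nonneg hc0 Metric.infDist_nonneg)
      rw [mul_pow]
      linarith
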